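/- Let $\Phi$ be a finite, reduced, crystallographic, irreducible root system with basis $\Delta$ of simple roots and Weyl-group-invariant scalar product $(\cdot,\cdot)$ on $\mathbf{R}\Phi$; put $\alpha^\vee = 2\alpha/(\alpha,\alpha)$. If all roots have the same length, all are called short. Write $\lambda\le\mu$ if $\mu-\lambda$ is a linear combination of simple roots with non-negative integral coefficients; let $\operatorname{supp}(x)\subset\Delta$ be the set of simple roots occurring in $x\in\mathbf{R}\Phi$ with non-zero coefficient; call $x$ dominant if $(x,\alpha^\vee)\ge 0$ for all $\alpha\in\Delta$. Let $\beta_1$ be the largest short root of $\Phi$ for $\le$. The (short-root variant of the) Kostant cascade $\mathcal{K}$ is the set of all roots obtained as follows. Start with the set $S=\Delta$ and the root $\beta_1$. Given a set $S$ of simple roots with $\beta$ the largest short root of $\Phi$ in $\mathbf{Z}S$, pass to each connected component $T$ (in the Dynkin diagram) of $\{\alpha\in S\mid(\beta,\alpha)=0\}$ which contains a short simple root, and to the largest short root of $\Phi$ in $\mathbf{Z}T$; repeat. A root $\beta\in\mathcal{K}$ is a predecessor of $\gamma\in\mathcal{K}$ if $\operatorname{supp}\gamma$ is a connected component of $\operatorname{supp}\beta\setminus\{\alpha\in\operatorname{supp}\beta\mid(\beta,\alpha)>0\}$,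 and $\preceq$ is the reflexive transitive closure on $\mathcal{K}$ of the predecessor relation. For $\beta\in\mathcal{K}$ set $$\xi_\beta=\sum_{\beta'\in\mathcal{K},\ \beta'\preceq\beta}\beta'.$$ Let $\alpha_0=-\beta_1$. The extended Dynkin diagram has vertex set $\Delta\cup\{\alpha_0\}$, two distinct vertices being linked if they are not orthogonal. For $\lambda\in\mathbf{R}\Phi$ set $\Delta_\lambda=\{\alpha\in\Delta\mid(\lambda,\alpha^\vee)=0\}$, and let $J(\lambda)\subset\Delta_\lambda$ be the subset such that $J(\lambda)\cup\{\alpha_0\}$ is the connected component of $\Delta_\lambda\cup\{\alpha_0\}$ containing $\alpha_0$ in the extended Dynkin diagram. **Proposition.** Let $\beta\in\mathcal{K}$. Then $\xi_\beta$ is dominant if and only if $\operatorname{supp}(\beta_1-\beta)\neq\Delta$. If $\xi_\beta$ is dominant, then $J(\xi_\beta)=\operatorname{supp}(\beta_1-\beta)$. -/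

import Mathlib

noncomputable section

namespace RootPairing.Base

variable {ι M N : Type*} [AddCommGroup M] [Module ℝ M] [AddCommGroup N] [Module ℝ N]
  {P : RootPairing ι ℝ M N}

/-- The support of a linear combination of simple roots: the set of the simple roots
(elements of `b.support`) that occur in it with a non-zero coefficient. -/
def suppOf [P.IsRootSystem] (b : P.Base) (x : M) : Set b.support :=
  {a | b.toWeightBasis.repr x a ≠ 0}

/-- The usual order: `x ≤ y` if and only if `y - x` is a linear combination of simple roots with
non-negative integral coefficients. -/
def RootLE (b : P.Base) (x y : M) : Prop :=
  y - x ∈ AddSubmonoid.closure (P.root '' (b.support : Set ι))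

/-- `x` is dominant: `(x, α^∨) ≥ 0` for all simple roots `α`. -/
def IsDominantWeight (b : P.Base) (x : M) : Prop :=
  ∀ a : b.support, 0 ≤ P.coroot' a x

/-- `Δ_x`, the set of the simple roots `α` with `(x, α^∨) = 0`. -/
def orthSimple (b : P.Base) (x : M) : Set b.support :=
  {a | P.coroot' a x = 0}

end RootPairing.Base

namespace RootPairing

variable {ι M N : Type*} [Fintype ι] [AddCommGroup M] [Module ℝ M] [AddCommGroup N] [Module ℝ N]

/-- A root of an irreducible root system is short if it has minimal length. In particular, all roots
are short if all have the same length. Here and below, `P.RootForm` is the canonical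
Weyl-group-invariant scalar product. For irreducible `P` it agrees up to a positive factor with
the one where short roots have square length `2`, and only comparisons of lengths and signs of
scalar products are used. -/
def IsShortRoot (P : RootPairing ι ℝ M N) (i : ι) : Prop :=
  ∀ j, P.RootForm (P.root i) (P.root i) ≤ P.RootForm (P.root j) (P.root j)

/-- The graph that links two distinct members of a family of vectors whenever they are not
orthogonal (the Dynkin diagram of the family, without multiplicities and arrows). -/
def linkGraph {V : Type*} (P : RootPairing ι ℝ M N) (v : V → M) : SimpleGraph V where
  Adj x y := x ≠ y ∧ P.RootForm (v x) (v y) ≠ 0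
  symm := ⟨fun x y h => ⟨h.1.symm, (P.rootForm_symmetric.eq (v x) (v y)).symm ▸ h.2⟩⟩
  loopless := ⟨fun _ h => h.1 rfl⟩

end RootPairing

/-- `T` is (the vertex set of) a connected component of the set `S` of vertices, i.e. of the
subgraph of `G` induced on `S`. -/
def SimpleGraph.IsComponentOf {V : Type*} (G : SimpleGraph V) (T S : Set V) : Prop :=
  ∃ c : (G.induce S).ConnectedComponent, T = Subtype.val '' c.supp

namespace RootPairing.Base

variable {ι M N : Type*} [Fintype ι] [AddCommGroup M] [Module ℝ M] [AddCommGroup N] [Module ℝ N]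
  {P : RootPairing ι ℝ M N}

/-- The graph underlying the Dynkin diagram; its vertices are the simple roots. -/
def dynkinGraph (b : P.Base) : SimpleGraph b.support :=
  P.linkGraph fun a => P.root a

/-- The graph underlying the extended Dynkin diagram. The vertex `none` is `α₀ = -β₁`. -/
def extDynkinGraph (b : P.Base) (β₁ : ι) : SimpleGraph (Option b.support) :=
  P.linkGraph fun o => o.elim (-P.root β₁) fun a => P.root a

/-- `β` is a short root in `Φ ∩ ℤS`, for a set `S` of simple roots. -/
def IsShortRootIn (b : P.Base) (S : Set b.support) (β : ι) : Prop :=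
  P.IsShortRoot β ∧ P.root β ∈ Submodule.span ℤ ((fun a : b.support => P.root a) '' S)

/-- `β` is the largest short root in `Φ ∩ ℤS`. -/
def IsLargestShortRoot (b : P.Base) (S : Set b.support) (β : ι) : Prop :=
  b.IsShortRootIn S β ∧ ∀ γ, b.IsShortRootIn S γ → b.RootLE (P.root γ) (P.root β)

/-- The pairs `(S, β)` encountered in the construction of the Kostant cascade: a connected set `S`
of simple roots, and the largest short root `β` in `Φ ∩ ℤS`. One starts with the set of all simple
roots. From `(S, β)` one passes to the connected components `T` of `{α ∈ S | (β, α) = 0}`. Those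
without short roots (i.e. without short simple roots) are discarded. -/
inductive CascadeStep (b : P.Base) : Set b.support → ι → Prop
  | first {β : ι} (h : b.IsLargestShortRoot Set.univ β) : CascadeStep b Set.univ β
  | next {S T : Set b.support} {β γ : ι} (hS : CascadeStep b S β)
      (hT : b.dynkinGraph.IsComponentOf T
        (S \ {a | P.RootForm (P.root β) (P.root a) ≠ 0}))
      (hγ : b.IsLargestShortRoot T γ) : CascadeStep b T γ

/-- The (short-root variant of the) Kostant cascade, as a set of indices of roots. -/
def kostantCascade (b : P.Base) : Set ι := {β | ∃ S, b.CascadeStep S β}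

/-- `β` is a predecessor of `γ` in the cascade: `Δ(γ) = supp γ` is a connected component of
`Δ(β) \ {α ∈ Δ(β) | (β, α) > 0}`. -/
def IsPredecessor [P.IsRootSystem] (b : P.Base) (β γ : ι) : Prop :=
  β ∈ b.kostantCascade ∧ γ ∈ b.kostantCascade ∧
    b.dynkinGraph.IsComponentOf (b.suppOf (P.root γ))
      (b.suppOf (P.root β) \ {a | 0 < P.RootForm (P.root β) (P.root a)})

/-- The partial order `β ⪯ γ` on the cascade: there is a chain of predecessors from `β` to `γ`. -/
def CascadeLE [P.IsRootSystem] (b : P.Base) (β γ : ι) : Prop :=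
  β ∈ b.kostantCascade ∧ γ ∈ b.kostantCascade ∧ Relation.ReflTransGen b.IsPredecessor β γ

open Classical in
/-- `ξ_β`, the sum of all `β'` in the cascade with `β' ⪯ β`. -/
def cascadeWeight [P.IsRootSystem] (b : P.Base) (β : ι) : M :=
  ∑ γ with b.CascadeLE γ β, P.root γ

/-- The set `Δ_x ∪ {α₀}` of vertices of the extended Dynkin diagram. -/
def extOrthSimple (b : P.Base) (x : M) : Set (Option b.support) :=
  insert none (some '' b.orthSimple x)

/-- `J(x)`: the set of simple roots such that `J(x) ∪ {α₀}` is the connected component of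
`Δ_x ∪ {α₀}` containing `α₀` in the extended Dynkin diagram. -/
def extComponent (b : P.Base) (β₁ : ι) (x : M) : Set b.support :=
  {a | some a ∈ Subtype.val '' (((b.extDynkinGraph β₁).induce
    (b.extOrthSimple x)).connectedComponentMk ⟨none, Set.mem_insert _ _⟩).supp}

end RootPairing.Base

end

/-!
The proof rests on two properties of the roots of the cascade: they are short, and the members
`β₁, …, β_r = β` of the cascade below `β` are pairwise orthogonal. More precisely, if `S` is the
support of `β`, then `S` is orthogonal to all of these except `β` itself. The supports of the
members of the cascade form a laminar family, so every member other than `β₁` has exactly one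
predecessor, and `ξ_β` is the sum of `β` and the weight of its predecessor
(`CascadeStep.cascadeWeight_next`).

Let `D = supp (β₁ - β)`. The difference `β₁ - β` is a non-negative combination of simple roots, and
orthogonality with equality of lengths gives `(ξ_β, β₁ - β) = (β₁, β₁) - (β, β) = 0`. If `ξ_β` is
dominant, then each simple root in `D` must therefore be orthogonal to `ξ_β`
(`CascadeStep.suppOf_sub_subset_orthSimple`). As `(ξ_β, β₁) > 0`, this forces `D ≠ Δ`.

Suppose conversely that the scalar product of `ξ_β` with some simple root `a` is negative. When it
first becomes negative along the chain from `β₁` to `β`, three consecutive members `β', β'', γ` pair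
with `a` to `1, -1, -1`. Then `β' - a - β'' - γ` is a positive root, so that `β'` has larger
coefficients than `γ` on the support of `γ`, and hence `D = Δ`
(`CascadeStep.repr_lt_of_coroot'_eq`, `CascadeStep.repr_lt_of_not_dominant`).

Now let `ξ_β` be dominant. In units of the square length of a short root, the root lattice is
integral, so short roots have minimal length in it (`IsShortRoot.rootForm_le`). If `D ∪ {α₀}` were
disconnected, `-β = α₀ + (β₁ - β)` would be a sum of two orthogonal non-zero elements of the root
lattice, which is absurd; thus `D ⊆ J(ξ_β)` (`CascadeStep.suppOf_sub_subset_extComponent`).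
Finally, a simple root outside `D` has the same non-zero coefficient in `β₁` and `β`, so it lies in
`S`; if it is orthogonal to `ξ_β`, then it is orthogonal to `β` and `β₁`, and so it is not linked
to `D ∪ {α₀}`. Thus `J(ξ_β) ⊆ D`.
-/

/-! ### Lengths and pairings of short roots -/

namespace RootPairing

variable {ι M N : Type*} [Fintype ι] [AddCommGroup M] [Module ℝ M] [AddCommGroup N] [Module ℝ N]
  {P : RootPairing ι ℝ M N}

lemma coroot'_mul_rootForm (P : RootPairing ι ℝ M N) (x : M) (i : ι) :
    P.coroot' i x * P.RootForm (P.root i) (P.root i) = 2 * P.RootForm x (P.root i) := by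
  have h := P.rootForm_reflection_reflection_apply i x (P.root i)
  rw [reflection_apply, reflection_apply_self, LinearMap.map_sub₂, LinearMap.map_smul₂,
    smul_eq_mul, map_neg, map_neg] at h
  linarith

lemma rootForm_comm (P : RootPairing ι ℝ M N) (x y : M) : P.RootForm x y = P.RootForm y x :=
  (P.rootForm_symmetric.eq y x).symm

lemma rootForm_root_pos (P : RootPairing ι ℝ M N) (i : ι) :
    0 < P.RootForm (P.root i) (P.root i) :=
  P.rootForm_pos_of_ne_zero (Submodule.subset_span ⟨i, rfl⟩) (P.ne_zero i)

lemma coroot'_nonneg_iff (P : RootPairing ι ℝ M N) {x : M} {i : ι} :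
    0 ≤ P.coroot' i x ↔ 0 ≤ P.RootForm x (P.root i) := by
  have h := P.coroot'_mul_rootForm x i
  have hp := P.rootForm_root_pos i
  constructor
  · intro hx
    have := mul_nonneg hx hp.le
    linarith
  · intro hx
    exact nonneg_of_mul_nonneg_left (by linarith) hp

lemma coroot'_eq_zero_iff (P : RootPairing ι ℝ M N) {x : M} {i : ι} :
    P.coroot' i x = 0 ↔ P.RootForm x (P.root i) = 0 := by
  have h := P.coroot'_mul_rootForm x i
  have hp := P.rootForm_root_pos i
  constructor
  · intro hx
    rw [hx] at h
    linarith
  · intro hx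
    rw [hx, mul_zero] at h
    exact (mul_eq_zero.mp h).resolve_right hp.ne'

lemma IsShortRoot.length_eq {i j : ι} (hi : P.IsShortRoot i) (hj : P.IsShortRoot j) :
    P.RootForm (P.root i) (P.root i) = P.RootForm (P.root j) (P.root j) :=
  le_antisymm (hi j) (hj i)

lemma IsShortRoot.of_length_eq {i j : ι} (hi : P.IsShortRoot i)
    (h : P.RootForm (P.root j) (P.root j) = P.RootForm (P.root i) (P.root i)) :
    P.IsShortRoot j :=
  fun k ↦ h ▸ hi k

lemma IsShortRoot.reflectionPerm {i : ι} (hi : P.IsShortRoot i) (j : ι) :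
    P.IsShortRoot (P.reflectionPerm j i) := by
  apply hi.of_length_eq
  rw [root_reflectionPerm, rootForm_reflection_reflection_apply]

section Crystallographic

variable [P.IsCrystallographic] [P.IsReduced]

/-- A short root pairs with the coroot of any root not proportional to it to `-1`, `0` or `1`. -/
lemma IsShortRoot.coroot'_mem {i j : ι} (hi : P.IsShortRoot i) (h : P.root i ≠ P.root j)
    (h' : P.root i ≠ -P.root j) :
    P.coroot' j (P.root i) = 0 ∨ P.coroot' j (P.root i) = 1 ∨ P.coroot' j (P.root i) = -1 := by
  have hm := P.pairingIn_pairingIn_mem_set_of_isCrystal_of_isRed' i j h h'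
  have e := P.toInvariantForm.pairing_mul_eq_pairing_mul_swap i j
  simp only [toInvariantForm_form] at e
  have hij := hi j
  have hp := P.rootForm_root_pos i
  rw [root_coroot'_eq_pairing]
  rw [← P.algebraMap_pairingIn ℤ, ← P.algebraMap_pairingIn ℤ] at e
  rw [← P.algebraMap_pairingIn ℤ]
  simp only [Set.mem_insert_iff, Set.mem_singleton_iff, Prod.mk.injEq] at hm
  rcases hm with ⟨h1, h2⟩ | ⟨h1, h2⟩ | ⟨h1, h2⟩ | ⟨h1, h2⟩ | ⟨h1, h2⟩ | ⟨h1, h2⟩ | ⟨h1, h2⟩ |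
      ⟨h1, h2⟩ | ⟨h1, h2⟩ | ⟨h1, h2⟩ | ⟨h1, h2⟩ <;>
    rw [h1, h2] at e <;> rw [h1] <;> norm_num at e ⊢ <;> linarith

variable [P.IsIrreducible]

/-- In an irreducible root system, the square length of a root is an integral multiple of that of
a short root, because every root is linked to some short root. -/
lemma IsShortRoot.exists_length_eq {i : ι} (hi : P.IsShortRoot i) (j : ι) :
    ∃ n : ℤ, P.RootForm (P.root j) (P.root j) = n * P.RootForm (P.root i) (P.root i) := by
  obtain ⟨k, hk, hjk⟩ := P.exists_form_eq_form_and_form_ne_zero P.toInvariantForm j i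
  simp only [toInvariantForm_form] at hk hjk
  by_cases h : P.root k = P.root j
  · exact ⟨1, by rw [← hk, h]; simp⟩
  by_cases h' : P.root k = -P.root j
  · exact ⟨1, by rw [← hk, h']; simp⟩
  have hks : P.IsShortRoot k := hi.of_length_eq hk
  have e := P.coroot'_mul_rootForm (P.root k) j
  have e' := P.coroot'_mul_rootForm (P.root j) k
  rw [P.rootForm_comm (P.root j) (P.root k), ← e, root_coroot'_eq_pairing,
    ← P.algebraMap_pairingIn ℤ, hk] at e'
  rcases hks.coroot'_mem h h' with h0 | h1 | h1
  · rw [coroot'_eq_zero_iff, rootForm_comm] at h0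
    exact absurd h0 hjk
  · exact ⟨P.pairingIn ℤ j k, by rw [h1] at e'; simp at e' ⊢; linarith⟩
  · exact ⟨-P.pairingIn ℤ j k, by rw [h1] at e'; simp at e' ⊢; linarith⟩

lemma IsShortRoot.exists_two_mul_rootForm_eq {i : ι} (hi : P.IsShortRoot i) {x y : M}
    (hx : x ∈ P.rootSpan ℤ) (hy : y ∈ P.rootSpan ℤ) :
    ∃ n : ℤ, 2 * P.RootForm x y = n * P.RootForm (P.root i) (P.root i) := by
  induction hy using Submodule.span_induction with
  | mem y hy =>
    obtain ⟨j, rfl⟩ := hy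
    obtain ⟨m, hm⟩ := P.coroot'_apply_apply_mem_of_mem_span ℤ hx j
    obtain ⟨n, hn⟩ := hi.exists_length_eq j
    refine ⟨m * n, ?_⟩
    rw [← coroot'_mul_rootForm, hn, ← hm]
    simp [mul_assoc]
  | zero => exact ⟨0, by simp⟩
  | add y z _ _ hy hz =>
    obtain ⟨m, hm⟩ := hy
    obtain ⟨n, hn⟩ := hz
    exact ⟨m + n, by rw [map_add, mul_add, hm, hn]; push_cast; ring⟩
  | smul t y _ hy =>
    obtain ⟨m, hm⟩ := hy
    exact ⟨t * m, by rw [map_zsmul, zsmul_eq_mul, mul_left_comm, hm]; push_cast; ring⟩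

/-- In units of the square length of a short root, the root lattice is an integral lattice. -/
lemma IsShortRoot.exists_rootForm_self_eq {i : ι} (hi : P.IsShortRoot i) {x : M}
    (hx : x ∈ P.rootSpan ℤ) :
    ∃ n : ℤ, P.RootForm x x = n * P.RootForm (P.root i) (P.root i) := by
  induction hx using Submodule.span_induction with
  | mem x hx =>
    obtain ⟨j, rfl⟩ := hx
    exact hi.exists_length_eq j
  | zero => exact ⟨0, by simp⟩
  | add x y hx' hy' hx hy =>
    obtain ⟨m, hm⟩ := hx
    obtain ⟨n, hn⟩ := hy
    obtain ⟨k, hk⟩ := hi.exists_two_mul_rootForm_eq hx' hy'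
    refine ⟨m + k + n, ?_⟩
    have := P.rootForm_comm x y
    simp only [map_add, LinearMap.add_apply]
    push_cast
    linarith
  | smul t x _ hx =>
    obtain ⟨m, hm⟩ := hx
    refine ⟨t * t * m, ?_⟩
    simp only [map_zsmul, LinearMap.smul_apply, zsmul_eq_mul, hm]
    push_cast
    ring

/-- Short roots have minimal length among all non-zero elements of the root lattice. -/
lemma IsShortRoot.rootForm_le [P.IsRootSystem] {i : ι} (hi : P.IsShortRoot i) {x : M}
    (hx : x ∈ P.rootSpan ℤ) (h0 : x ≠ 0) :
    P.RootForm (P.root i) (P.root i) ≤ P.RootForm x x := by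
  obtain ⟨n, hn⟩ := hi.exists_rootForm_self_eq hx
  have hp := P.rootForm_root_pos i
  have hx : 0 < P.RootForm x x := P.rootForm_pos_of_ne_zero (by simp) h0
  rw [hn] at hx ⊢
  have : (1 : ℝ) ≤ n := by exact_mod_cast (pos_of_mul_pos_left hx hp.le : (0 : ℝ) < n)
  nlinarith

end Crystallographic

end RootPairing

/-! ### Coefficients with respect to the simple roots -/

namespace RootPairing.Base

variable {ι M N : Type*} [AddCommGroup M] [Module ℝ M] [AddCommGroup N] [Module ℝ N]
  {P : RootPairing ι ℝ M N} [P.IsRootSystem]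

lemma repr_nonneg_of_mem_closure (b : P.Base) {x : M}
    (hx : x ∈ AddSubmonoid.closure (P.root '' (b.support : Set ι))) (a : b.support) :
    0 ≤ b.toWeightBasis.repr x a := by
  classical
  induction hx using AddSubmonoid.closure_induction with
  | mem x hx =>
    obtain ⟨i, hi, rfl⟩ := hx
    rw [b.toWeightBasis_repr_root ⟨i, hi⟩, Finsupp.single_apply]
    split_ifs <;> norm_num
  | zero => simp
  | add x y _ _ hx hy => simpa using add_nonneg hx hy

lemma RootLE.repr_le {b : P.Base} {x y : M} (h : b.RootLE x y) (a : b.support) :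
    b.toWeightBasis.repr x a ≤ b.toWeightBasis.repr y a := by
  have := b.repr_nonneg_of_mem_closure h a
  simpa using this

lemma RootLE.antisymm {b : P.Base} {x y : M} (h : b.RootLE x y) (h' : b.RootLE y x) : x = y :=
  b.toWeightBasis.repr.injective <| Finsupp.ext fun a ↦ le_antisymm (h.repr_le a) (h'.repr_le a)

lemma repr_root_nonneg_or_nonpos (b : P.Base) (i : ι) :
    (∀ a, 0 ≤ b.toWeightBasis.repr (P.root i) a) ∨
      ∀ a, b.toWeightBasis.repr (P.root i) a ≤ 0 := by
  rcases b.root_mem_or_neg_mem i with h | h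
  · exact Or.inl (b.repr_nonneg_of_mem_closure h)
  · exact Or.inr fun a ↦ by simpa using b.repr_nonneg_of_mem_closure h a

lemma repr_eq_zero_of_mem_span (b : P.Base) {S : Set b.support} {x : M}
    (hx : x ∈ Submodule.span ℤ ((fun a : b.support => P.root a) '' S)) {a : b.support}
    (ha : a ∉ S) : b.toWeightBasis.repr x a = 0 := by
  classical
  induction hx using Submodule.span_induction with
  | mem x hx =>
    obtain ⟨c, hc, rfl⟩ := hx
    rw [b.toWeightBasis_repr_root, Finsupp.single_apply, if_neg]
    rintro rfl
    exact ha hc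
  | zero => simp
  | add x y _ _ hx hy => simp [hx, hy]
  | smul t x _ hx => simp [hx]

lemma exists_int_repr_eq (b : P.Base) {x : M} (hx : x ∈ P.rootSpan ℤ) (a : b.support) :
    ∃ n : ℤ, b.toWeightBasis.repr x a = n := by
  classical
  rw [rootSpan, ← b.span_int_root_support] at hx
  induction hx using Submodule.span_induction with
  | mem x hx =>
    obtain ⟨i, hi, rfl⟩ := hx
    rw [b.toWeightBasis_repr_root ⟨i, hi⟩, Finsupp.single_apply]
    split_ifs
    exacts [⟨1, by simp⟩, ⟨0, by simp⟩]
  | zero => exact ⟨0, by simp⟩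
  | add x y _ _ hx hy =>
    obtain ⟨m, hm⟩ := hx
    obtain ⟨n, hn⟩ := hy
    exact ⟨m + n, by simp [hm, hn]⟩
  | smul t x _ hx =>
    obtain ⟨m, hm⟩ := hx
    exact ⟨t * m, by simp [hm]⟩

lemma suppOf_nonempty (b : P.Base) {x : M} (hx : x ≠ 0) : (b.suppOf x).Nonempty := by
  by_contra h
  rw [Set.not_nonempty_iff_eq_empty] at h
  apply hx
  apply b.toWeightBasis.repr.injective
  ext a
  have : a ∉ b.suppOf x := h ▸ Set.notMem_empty a
  simpa [suppOf] using this

variable [Fintype ι]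

lemma rootForm_eq_sum (b : P.Base) (x y : M) :
    P.RootForm x y = ∑ a, b.toWeightBasis.repr x a * P.RootForm (P.root a) y := by
  conv_lhs => rw [← b.toWeightBasis.sum_repr x]
  simp [LinearMap.sum_apply]

lemma rootForm_nonneg (b : P.Base) {x y : M} (hx : ∀ a, 0 ≤ b.toWeightBasis.repr x a)
    (hy : ∀ a ∈ b.suppOf x, 0 ≤ P.RootForm (P.root a) y) : 0 ≤ P.RootForm x y := by
  rw [b.rootForm_eq_sum]
  refine Finset.sum_nonneg fun a _ ↦ ?_
  by_cases h : b.toWeightBasis.repr x a = 0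
  · simp [h]
  · exact mul_nonneg (hx a) (hy a h)

lemma rootForm_eq_zero (b : P.Base) {x y : M}
    (hy : ∀ a ∈ b.suppOf x, P.RootForm (P.root a) y = 0) : P.RootForm x y = 0 := by
  rw [b.rootForm_eq_sum]
  refine Finset.sum_eq_zero fun a _ ↦ ?_
  by_cases h : b.toWeightBasis.repr x a = 0
  · simp [h]
  · simp [hy a h]

omit [P.IsRootSystem] in
lemma rootForm_simple_le_zero [P.IsCrystallographic] (b : P.Base) {a c : b.support}
    (h : a ≠ c) : P.RootForm (P.root a) (P.root c) ≤ 0 := by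
  have h1 := b.pairingIn_le_zero_of_ne (fun e ↦ h (Subtype.ext e)) a.2 c.2
  have h2 := P.coroot'_mul_rootForm (P.root a) c
  have h3 := P.rootForm_root_pos c
  rw [root_coroot'_eq_pairing, ← P.algebraMap_pairingIn ℤ] at h2
  have h4 : (P.pairingIn ℤ a c : ℝ) ≤ 0 := by exact_mod_cast h1
  have := mul_nonpos_of_nonpos_of_nonneg h4 h3.le
  simp only [algebraMap_int_eq, eq_intCast] at h2
  linarith

/-- A simple root outside the support of a non-negative combination of simple roots, but linked
to it, forms an obtuse angle with it. -/
lemma rootForm_neg_of_adj [P.IsCrystallographic] (b : P.Base) {x : M}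
    (hx : ∀ a, 0 ≤ b.toWeightBasis.repr x a) {a c : b.support} (ha : a ∉ b.suppOf x)
    (hc : c ∈ b.suppOf x) (hca : P.RootForm (P.root c) (P.root a) ≠ 0) :
    P.RootForm x (P.root a) < 0 := by
  have hne (c) (hc : c ∈ b.suppOf x) : c ≠ a := by
    rintro rfl
    exact ha hc
  rw [b.rootForm_eq_sum]
  refine Finset.sum_neg' (fun d _ ↦ ?_) ⟨c, Finset.mem_univ _, ?_⟩
  · by_cases hd : b.toWeightBasis.repr x d = 0
    · simp [hd]
    · exact mul_nonpos_of_nonneg_of_nonpos (hx d) (b.rootForm_simple_le_zero (hne d hd))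
  · exact mul_neg_of_pos_of_neg (lt_of_le_of_ne (hx c) (Ne.symm hc))
      (lt_of_le_of_ne (b.rootForm_simple_le_zero (hne c hc)) hca)

/-! ### Largest short roots -/

section LargestShortRoot

variable {b : P.Base} {S T : Set b.support} {β γ : ι}

lemma IsLargestShortRoot.repr_nonneg (h : b.IsLargestShortRoot S β) (a : b.support) :
    0 ≤ b.toWeightBasis.repr (P.root β) a := by
  have hn : b.IsShortRootIn S (P.reflectionPerm β β) := by
    refine ⟨h.1.1.reflectionPerm β, ?_⟩
    rw [root_reflectionPerm, reflection_apply_self]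
    exact neg_mem h.1.2
  have := (h.2 _ hn).repr_le a
  rw [root_reflectionPerm, reflection_apply_self, map_neg, Finsupp.neg_apply] at this
  linarith

lemma IsLargestShortRoot.suppOf_subset (h : b.IsLargestShortRoot S β) :
    b.suppOf (P.root β) ⊆ S := by
  intro a ha
  by_contra haS
  exact ha (b.repr_eq_zero_of_mem_span h.1.2 haS)

lemma IsLargestShortRoot.unique (h : b.IsLargestShortRoot S β) (h' : b.IsLargestShortRoot S γ) :
    β = γ :=
  P.root.injective ((h'.2 _ h.1).antisymm (h.2 _ h'.1))

lemma IsLargestShortRoot.repr_le_of_subset (h : b.IsLargestShortRoot S β)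
    (h' : b.IsLargestShortRoot T γ) (hTS : T ⊆ S) (a : b.support) :
    b.toWeightBasis.repr (P.root γ) a ≤ b.toWeightBasis.repr (P.root β) a :=
  (h.2 γ ⟨h'.1.1, Submodule.span_mono (Set.image_mono hTS) h'.1.2⟩).repr_le a

variable [P.IsCrystallographic]

/-- The largest short root of a parabolic subsystem is dominant there: otherwise a simple
reflection would make it larger. -/
lemma IsLargestShortRoot.rootForm_nonneg (h : b.IsLargestShortRoot S β) {a : b.support}
    (ha : a ∈ S) : 0 ≤ P.RootForm (P.root β) (P.root a) := by
  have hr : P.root (P.reflectionPerm a β) = P.root β - P.pairingIn ℤ β a • P.root a := by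
    rw [root_reflectionPerm, P.reflection_apply_root' ℤ]
  have hn : b.IsShortRootIn S (P.reflectionPerm a β) := by
    refine ⟨h.1.1.reflectionPerm a, ?_⟩
    rw [hr]
    exact sub_mem h.1.2 (zsmul_mem (Submodule.subset_span (Set.mem_image_of_mem _ ha)) _)
  have := (h.2 _ hn).repr_le a
  rw [hr, map_sub, map_zsmul, b.toWeightBasis_repr_root] at this
  simp only [Finsupp.sub_apply, Finsupp.smul_apply, Finsupp.single_eq_same, zsmul_eq_mul,
    mul_one] at this
  rw [← coroot'_nonneg_iff, root_coroot'_eq_pairing, ← P.algebraMap_pairingIn ℤ]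
  simpa using this

/-- The largest short root of `Φ ∩ ℤS` has support `S` if `S` is connected, i.e. if no proper
non-empty subset of `S` is closed under passing to neighbours in `S`. -/
lemma IsLargestShortRoot.suppOf_eq (h : b.IsLargestShortRoot S β)
    (hS : ∀ U ⊆ S, U.Nonempty → (∀ c ∈ U, ∀ a ∈ S, b.dynkinGraph.Adj c a → a ∈ U) → U = S) :
    b.suppOf (P.root β) = S := by
  refine hS _ h.suppOf_subset (b.suppOf_nonempty (P.ne_zero β)) fun c hc a ha hca ↦ ?_
  by_contra has
  exact (h.rootForm_nonneg ha).not_gt (b.rootForm_neg_of_adj h.repr_nonneg has hc hca.2)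

/-- The Dynkin diagram of an irreducible root system is connected. -/
lemma eq_univ_of_forall_adj [P.IsReduced] [P.IsIrreducible] (b : P.Base) {U : Set b.support}
    (hne : U.Nonempty) (hU : ∀ c ∈ U, ∀ a, b.dynkinGraph.Adj c a → a ∈ U) : U = Set.univ := by
  set q := Submodule.span ℝ ((fun a : b.support => P.root a) '' U) with hq
  have hinv : ∀ i ∈ b.support, q ∈ Module.End.invtSubmodule (P.reflection i) := by
    intro i hi
    by_cases hiU : (⟨i, hi⟩ : b.support) ∈ U
    · exact Submodule.mem_invtSubmodule_reflection_of_mem _ _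
        (Submodule.subset_span ⟨⟨i, hi⟩, hiU, rfl⟩)
    · have hz : ∀ x ∈ q, P.RootForm x (P.root i) = 0 := by
        intro x hx
        induction hx using Submodule.span_induction with
        | mem x hx =>
          obtain ⟨c, hc, rfl⟩ := hx
          by_contra h
          refine hiU (hU c hc ⟨i, hi⟩ ⟨?_, h⟩)
          rintro rfl
          exact hiU hc
        | zero => simp
        | add x y _ _ hx hy => simp [hx, hy]
        | smul t x _ hx => simp [hx]
      refine (Module.End.mem_invtSubmodule _).mpr fun x hx ↦ ?_
      rw [Submodule.mem_comap, LinearEquiv.coe_coe, reflection_apply,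
        P.coroot'_eq_zero_iff.mpr (hz x hx)]
      simpa using hx
  have htop : q = ⊤ := by
    refine IsIrreducible.eq_top_of_invtSubmodule_reflection (P := P) q
      ((b.forall_mem_support_invtSubmodule_iff q).mp hinv) fun h0 ↦ ?_
    obtain ⟨c, hc⟩ := hne
    have : P.root c ∈ q := Submodule.subset_span ⟨c, hc, rfl⟩
    rw [h0, Submodule.mem_bot] at this
    exact P.ne_zero c this
  ext a
  simp only [Set.mem_univ, iff_true]
  have ha : b.toWeightBasis a ∈ Submodule.span ℝ (b.toWeightBasis '' U) := by
    have : b.toWeightBasis '' U = (fun a : b.support => P.root a) '' U := by simp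
    rw [this, ← hq, htop]
    trivial
  rw [Module.Basis.mem_span_image] at ha
  simpa using ha

end LargestShortRoot

end RootPairing.Base

/-! ### Components of sets of vertices -/

namespace SimpleGraph.IsComponentOf

variable {V : Type*} {G : SimpleGraph V} {S T T' : Set V}

lemma subset (h : G.IsComponentOf T S) : T ⊆ S := by
  obtain ⟨c, rfl⟩ := h
  rintro _ ⟨x, -, rfl⟩
  exact x.2

lemma mem_of_adj (h : G.IsComponentOf T S) {x y : V} (hx : x ∈ T) (hy : y ∈ S)
    (hxy : G.Adj x y) : y ∈ T := by
  obtain ⟨c, rfl⟩ := h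
  obtain ⟨x, hx, rfl⟩ := hx
  have hadj : (G.induce S).Adj x ⟨y, hy⟩ := hxy
  refine ⟨⟨y, hy⟩, ?_, rfl⟩
  rw [ConnectedComponent.mem_supp_iff] at hx ⊢
  rw [← hx]
  exact (ConnectedComponent.sound hadj.reachable).symm

lemma eq_of_forall_adj (h : G.IsComponentOf T S) {U : Set V} (hU : U ⊆ T) (hne : U.Nonempty)
    (hadj : ∀ x ∈ U, ∀ y ∈ T, G.Adj x y → y ∈ U) : U = T := by
  refine hU.antisymm fun y hy ↦ ?_
  have hh := h
  obtain ⟨c, rfl⟩ := h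
  obtain ⟨x, hx⟩ := hne
  obtain ⟨x', hx', rfl⟩ := hU hx
  obtain ⟨y', hy', rfl⟩ := hy
  rw [ConnectedComponent.mem_supp_iff] at hx' hy'
  have hr : (G.induce S).Reachable x' y' := ConnectedComponent.exact (hx'.trans hy'.symm)
  rw [reachable_iff_reflTransGen] at hr
  induction hr with
  | refl => exact hx
  | @tail u v huv hadj' ih =>
    have hu : c = (G.induce S).connectedComponentMk u := by
      rw [← hx']
      exact ConnectedComponent.sound ((reachable_iff_reflTransGen _ _).mpr huv)
    exact hadj u (ih hu.symm) v ⟨v, hy', rfl⟩ hadj'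

lemma eq_or_disjoint (h : G.IsComponentOf T S) (h' : G.IsComponentOf T' S) :
    T = T' ∨ Disjoint T T' := by
  obtain ⟨c, rfl⟩ := h
  obtain ⟨c', rfl⟩ := h'
  by_cases hc : c = c'
  · exact Or.inl (by rw [hc])
  · refine Or.inr (Set.disjoint_image_of_injective Subtype.val_injective ?_)
    exact pairwise_disjoint_supp_connectedComponent _ hc

end SimpleGraph.IsComponentOf

/-! ### The cascade as a rooted tree -/

namespace RootPairing.Base

variable {ι M N : Type*} [Fintype ι] [AddCommGroup M] [Module ℝ M] [AddCommGroup N] [Module ℝ N]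
  {P : RootPairing ι ℝ M N} [P.IsRootSystem] [P.IsCrystallographic] [P.IsReduced]
  [P.IsIrreducible] {b : P.Base} {S S' T : Set b.support} {β β' γ δ : ι}

omit [P.IsRootSystem] [P.IsCrystallographic] [P.IsReduced] [P.IsIrreducible] in
lemma CascadeStep.isLargestShortRoot (h : b.CascadeStep S β) : b.IsLargestShortRoot S β := by
  cases h with
  | first h => exact h
  | next _ _ h => exact h

lemma CascadeStep.suppOf_eq (h : b.CascadeStep S β) : b.suppOf (P.root β) = S := by
  refine h.isLargestShortRoot.suppOf_eq fun U hU hne hadj ↦ ?_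
  cases h with
  | first h => exact b.eq_univ_of_forall_adj hne fun c hc a ↦ hadj c hc a trivial
  | next _ hT _ => exact hT.eq_of_forall_adj hU hne hadj

lemma CascadeStep.nonempty (h : b.CascadeStep S β) : S.Nonempty :=
  h.suppOf_eq ▸ b.suppOf_nonempty (P.ne_zero β)

/-- The simple roots of `S` orthogonal to `β` are not all of `S`, since `(β, β) > 0`. -/
lemma CascadeStep.exists_rootForm_ne_zero (h : b.CascadeStep S β) :
    ∃ a ∈ S, P.RootForm (P.root β) (P.root a) ≠ 0 := by
  by_contra! hc
  refine (P.rootForm_root_pos β).ne' (b.rootForm_eq_zero fun a ha ↦ ?_)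
  rw [rootForm_comm]
  exact hc a (h.suppOf_eq ▸ ha)

/-- Two members `(S, β)` and `(S', β')` of the cascade are nested or disjoint: `S = S'`, or
`S ∩ S' = ∅`, or one of `S`, `S'` lies in a component of the part of the other one that is
orthogonal to its root. -/
def AreLaminar (b : P.Base) (S : Set b.support) (β : ι) (S' : Set b.support) (β' : ι) : Prop :=
  S = S' ∨ Disjoint S S' ∨
    (∃ C, b.dynkinGraph.IsComponentOf C
      (S \ {a | P.RootForm (P.root β) (P.root a) ≠ 0}) ∧ S' ⊆ C) ∨
    ∃ C, b.dynkinGraph.IsComponentOf C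
      (S' \ {a | P.RootForm (P.root β') (P.root a) ≠ 0}) ∧ S ⊆ C

omit [P.IsCrystallographic] [P.IsReduced] [P.IsIrreducible] in
/-- It suffices to compare `(S, β)` with the members `(S', β')` such that `S ⊆ S'`. -/
lemma CascadeStep.areLaminar_of_forall_subset (h : b.CascadeStep S β)
    (key : ∀ S' β', b.CascadeStep S' β' → S ⊆ S' → b.AreLaminar S β S' β')
    (h' : b.CascadeStep S' β') : b.AreLaminar S β S' β' := by
  induction h' with
  | first h' => exact key _ _ (.first h') (Set.subset_univ _)
  | @next S₁ T β₁ γ hS₁ hT hγ ih =>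
    have hsub : T ⊆ S₁ := hT.subset.trans Set.sdiff_subset
    rcases ih with rfl | hd | ⟨C, hC, hsC⟩ | ⟨C, hC, hsC⟩
    · obtain rfl := h.isLargestShortRoot.unique hS₁.isLargestShortRoot
      exact Or.inr (Or.inr (Or.inl ⟨T, hT, subset_rfl⟩))
    · exact Or.inr (Or.inl (hd.mono_right hsub))
    · exact Or.inr (Or.inr (Or.inl ⟨C, hC, hsub.trans hsC⟩))
    · rcases hC.eq_or_disjoint hT with rfl | hd
      · exact key _ _ (.next hS₁ hT hγ) hsC
      · exact Or.inr (Or.inl (hd.mono_left hsC))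

omit [P.IsCrystallographic] [P.IsReduced] [P.IsIrreducible] in
lemma CascadeStep.areLaminar (h : b.CascadeStep S β) (h' : b.CascadeStep S' β') :
    b.AreLaminar S β S' β' := by
  induction h generalizing S' β' with
  | first h =>
    refine (CascadeStep.first h).areLaminar_of_forall_subset (fun S' β' _ hs ↦ Or.inl ?_) h'
    exact (Set.univ_subset_iff.mp hs).symm
  | @next S₀ S β₀ β hS₀ hS hβ ih =>
    refine (CascadeStep.next hS₀ hS hβ).areLaminar_of_forall_subset (fun S' β' h' hs ↦ ?_) h'
    have hsub : S ⊆ S₀ := hS.subset.trans Set.sdiff_subset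
    rcases ih h' with rfl | hd | ⟨C, hC, hsC⟩ | ⟨C, hC, hsC⟩
    · obtain rfl := hS₀.isLargestShortRoot.unique h'.isLargestShortRoot
      exact Or.inr (Or.inr (Or.inr ⟨S, hS, subset_rfl⟩))
    · exact Or.inr (Or.inl (hd.mono_left hsub))
    · rcases hC.eq_or_disjoint hS with rfl | hd
      · exact Or.inl (hs.antisymm hsC)
      · exact Or.inr (Or.inl (hd.symm.mono_right hsC))
    · exact Or.inr (Or.inr (Or.inr ⟨C, hC, hsub.trans hsC⟩))

/-- Each member of the cascade arises from only one other member. -/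
lemma CascadeStep.eq_of_isComponentOf (h : b.CascadeStep S β) (h' : b.CascadeStep S' β')
    (hT : b.dynkinGraph.IsComponentOf T (S \ {a | P.RootForm (P.root β) (P.root a) ≠ 0}))
    (hT' : b.dynkinGraph.IsComponentOf T (S' \ {a | P.RootForm (P.root β') (P.root a) ≠ 0}))
    (hne : T.Nonempty) : β = β' := by
  obtain ⟨x, hx⟩ := hne
  have key {S S' : Set b.support} {β β' : ι} (h' : b.CascadeStep S' β')
      (hT : b.dynkinGraph.IsComponentOf T (S \ {a | P.RootForm (P.root β) (P.root a) ≠ 0}))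
      (hT' : b.dynkinGraph.IsComponentOf T (S' \ {a | P.RootForm (P.root β') (P.root a) ≠ 0}))
      {C : Set b.support}
      (hC : b.dynkinGraph.IsComponentOf C (S \ {a | P.RootForm (P.root β) (P.root a) ≠ 0}))
      (hsub : S' ⊆ C) : False := by
    rcases hC.eq_or_disjoint hT with rfl | hd
    · obtain ⟨a, ha, ha'⟩ := h'.exists_rootForm_ne_zero
      exact (hT'.subset (hsub ha)).2 ha'
    · exact Set.disjoint_left.mp hd (hsub (hT'.subset hx).1) hx
  rcases h.areLaminar h' with rfl | hd | ⟨C, hC, hsub⟩ | ⟨C, hC, hsub⟩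
  · exact h.isLargestShortRoot.unique h'.isLargestShortRoot
  · exact (Set.disjoint_left.mp hd (hT.subset hx).1 (hT'.subset hx).1).elim
  · exact (key h' hT hT' hC hsub).elim
  · exact (key h hT' hT hC hsub).elim

omit [P.IsReduced] [P.IsIrreducible] in
/-- On the support of a member of the cascade, the simple roots not orthogonal to it are those
with positive scalar product. -/
lemma CascadeStep.sdiff_pos_eq (h : b.CascadeStep S β) :
    S \ {a | 0 < P.RootForm (P.root β) (P.root a)} =
      S \ {a | P.RootForm (P.root β) (P.root a) ≠ 0} := by
  ext a
  refine and_congr_right fun ha ↦ not_congr ?_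
  exact ⟨fun hlt ↦ LT.lt.ne' hlt, fun hne ↦ lt_of_le_of_ne (h.isLargestShortRoot.rootForm_nonneg ha) hne.symm⟩

lemma CascadeStep.isPredecessor (hS : b.CascadeStep S β)
    (hT : b.dynkinGraph.IsComponentOf T (S \ {a | P.RootForm (P.root β) (P.root a) ≠ 0}))
    (hγ : b.IsLargestShortRoot T γ) : b.IsPredecessor β γ := by
  have h := CascadeStep.next hS hT hγ
  refine ⟨⟨S, hS⟩, ⟨T, h⟩, ?_⟩
  rwa [h.suppOf_eq, hS.suppOf_eq, hS.sdiff_pos_eq]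

lemma IsPredecessor.eq (hδ : b.IsPredecessor δ γ) (hS : b.CascadeStep S β)
    (hT : b.dynkinGraph.IsComponentOf T (S \ {a | P.RootForm (P.root β) (P.root a) ≠ 0}))
    (hγ : b.IsLargestShortRoot T γ) : δ = β := by
  obtain ⟨⟨S', hS'⟩, -, hc⟩ := hδ
  have h := CascadeStep.next hS hT hγ
  rw [h.suppOf_eq, hS'.suppOf_eq, hS'.sdiff_pos_eq] at hc
  exact hS'.eq_of_isComponentOf hS hc hT h.nonempty

lemma not_isPredecessor_first (h : b.IsLargestShortRoot Set.univ β) :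
    ¬ b.IsPredecessor δ β := by
  rintro ⟨⟨S', hS'⟩, -, hc⟩
  rw [(CascadeStep.first h).suppOf_eq, hS'.suppOf_eq, hS'.sdiff_pos_eq] at hc
  obtain ⟨a, -, ha⟩ := hS'.exists_rootForm_ne_zero
  exact (hc.subset (Set.mem_univ a)).2 ha

omit [P.IsCrystallographic] [P.IsReduced] [P.IsIrreducible] in
lemma CascadeLE.suppOf_subset (h : b.CascadeLE β γ) :
    b.suppOf (P.root γ) ⊆ b.suppOf (P.root β) := by
  obtain ⟨-, -, h⟩ := h
  induction h with
  | refl => exact subset_rfl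
  | tail _ h ih => exact (h.2.2.subset.trans Set.sdiff_subset).trans ih

omit [P.IsCrystallographic] [P.IsReduced] [P.IsIrreducible] in
lemma CascadeLE.refl (h : β ∈ b.kostantCascade) : b.CascadeLE β β :=
  ⟨h, h, .refl⟩

lemma cascadeLE_first_iff (h : b.IsLargestShortRoot Set.univ β) :
    b.CascadeLE δ β ↔ δ = β := by
  constructor
  · rintro ⟨-, -, hr⟩
    rcases hr.cases_tail with h' | ⟨ε, -, h'⟩
    · exact h'.symm
    · exact (not_isPredecessor_first h h').elim
  · rintro rfl
    exact .refl ⟨_, .first h⟩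

lemma CascadeStep.cascadeLE_next_iff (hS : b.CascadeStep S β)
    (hT : b.dynkinGraph.IsComponentOf T (S \ {a | P.RootForm (P.root β) (P.root a) ≠ 0}))
    (hγ : b.IsLargestShortRoot T γ) : b.CascadeLE δ γ ↔ δ = γ ∨ b.CascadeLE δ β := by
  have hγK : γ ∈ b.kostantCascade := ⟨T, .next hS hT hγ⟩
  constructor
  · rintro ⟨hδ, -, hr⟩
    rcases hr.cases_tail with h' | ⟨ε, hr, h'⟩
    · exact Or.inl h'.symm
    · obtain rfl := h'.eq hS hT hγ
      exact Or.inr ⟨hδ, ⟨S, hS⟩, hr⟩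
  · rintro (rfl | ⟨hδ, -, hr⟩)
    · exact .refl hγK
    · exact ⟨hδ, hγK, hr.tail (hS.isPredecessor hT hγ)⟩

lemma cascadeWeight_first (h : b.IsLargestShortRoot Set.univ β) :
    b.cascadeWeight β = P.root β := by
  classical
  simp only [cascadeWeight, cascadeLE_first_iff h]
  rw [Finset.filter_eq' Finset.univ β]
  simp

lemma CascadeStep.cascadeWeight_next (hS : b.CascadeStep S β)
    (hT : b.dynkinGraph.IsComponentOf T (S \ {a | P.RootForm (P.root β) (P.root a) ≠ 0}))
    (hγ : b.IsLargestShortRoot T γ) :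
    b.cascadeWeight γ = b.cascadeWeight β + P.root γ := by
  classical
  have hnot : ¬ b.CascadeLE γ β := by
    intro h
    have hsub := h.suppOf_subset
    rw [hS.suppOf_eq, (CascadeStep.next hS hT hγ).suppOf_eq] at hsub
    obtain ⟨a, ha, ha'⟩ := hS.exists_rootForm_ne_zero
    exact (hT.subset (hsub ha)).2 ha'
  have hins : (Finset.univ.filter fun δ ↦ b.CascadeLE δ γ) =
      insert γ (Finset.univ.filter fun δ ↦ b.CascadeLE δ β) := by
    ext δ
    simp [hS.cascadeLE_next_iff hT hγ]
  rw [add_comm, cascadeWeight, cascadeWeight]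
  convert Finset.sum_insert (s := Finset.univ.filter fun δ ↦ b.CascadeLE δ β)
    (f := fun δ ↦ P.root δ) (a := γ) (by simpa using hnot)

end RootPairing.Base

/-! ### Dominance of the cascade weights -/

namespace RootPairing.Base

variable {ι M N : Type*} [Fintype ι] [AddCommGroup M] [Module ℝ M] [AddCommGroup N] [Module ℝ N]
  {P : RootPairing ι ℝ M N} [P.IsRootSystem] [P.IsCrystallographic] [P.IsReduced]
  [P.IsIrreducible] {b : P.Base} {S S' T : Set b.support} {β β' β₁ γ : ι}

lemma CascadeStep.repr_pos (h : b.CascadeStep S β) {a : b.support} (ha : a ∈ S) :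
    0 < b.toWeightBasis.repr (P.root β) a :=
  lt_of_le_of_ne (h.isLargestShortRoot.repr_nonneg a) (Ne.symm (h.suppOf_eq.symm ▸ ha :))

lemma CascadeStep.repr_eq_zero (h : b.CascadeStep S β) {a : b.support} (ha : a ∉ S) :
    b.toWeightBasis.repr (P.root β) a = 0 := by
  by_contra hne
  have hmem : a ∈ b.suppOf (P.root β) := hne
  exact ha (h.suppOf_eq ▸ hmem)

/-- A simple root outside `S` that is linked to `S` pairs to `-1` with the root `β` of the
cascade, because `β` is short. -/
lemma CascadeStep.coroot'_eq_neg_one (h : b.CascadeStep S β) {a c : b.support} (ha : a ∉ S)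
    (hc : c ∈ S) (hca : P.RootForm (P.root c) (P.root a) ≠ 0) :
    P.coroot' a (P.root β) = -1 := by
  have hneg := b.rootForm_neg_of_adj h.isLargestShortRoot.repr_nonneg
    (h.suppOf_eq.symm ▸ ha : a ∉ b.suppOf (P.root β)) (h.suppOf_eq.symm ▸ hc) hca
  have hp := P.rootForm_root_pos a
  have he := P.coroot'_mul_rootForm (P.root β) a
  have hβ : 0 < b.toWeightBasis.repr (P.root β) c := h.repr_pos hc
  have hac : c ≠ a := fun e ↦ ha (e ▸ hc)
  have hz : b.toWeightBasis.repr (P.root a) c = 0 := by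
    classical
    rw [b.toWeightBasis_repr_root, Finsupp.single_apply, if_neg hac.symm]
  have h1 : P.root β ≠ P.root a := by
    intro e
    rw [e, hz] at hβ
    exact lt_irrefl _ hβ
  have h2 : P.root β ≠ -P.root a := by
    intro e
    rw [e, map_neg, Finsupp.neg_apply, hz, neg_zero] at hβ
    exact lt_irrefl _ hβ
  rcases h.isLargestShortRoot.1.1.coroot'_mem h1 h2 with h0 | h0 | h0
  · rw [h0] at he
    linarith
  · rw [h0] at he
    linarith
  · exact h0

omit [P.IsRootSystem] [P.IsIrreducible] in
lemma coroot'_mem_of_adj (h : P.IsShortRoot β) {a c : b.support}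
    (hc : P.RootForm (P.root β) (P.root c) = 0)
    (hca : P.RootForm (P.root c) (P.root a) ≠ 0) :
    P.coroot' a (P.root β) = 0 ∨ P.coroot' a (P.root β) = 1 ∨ P.coroot' a (P.root β) = -1 := by
  have h1 : P.root β ≠ P.root a := by
    intro e
    rw [e, rootForm_comm] at hc
    exact hca hc
  have h2 : P.root β ≠ -P.root a := by
    intro e
    rw [e, rootForm_comm, map_neg, neg_eq_zero] at hc
    exact hca hc
  exact h.coroot'_mem h1 h2

omit [P.IsRootSystem] [P.IsCrystallographic] [P.IsReduced] [P.IsIrreducible] in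
lemma rootForm_eq_zero_of_isComponentOf
    (hT : b.dynkinGraph.IsComponentOf T (S \ {a | P.RootForm (P.root β) (P.root a) ≠ 0}))
    {a : b.support} (ha : a ∈ T) : P.RootForm (P.root β) (P.root a) = 0 :=
  not_not.mp (hT.subset ha).2

omit [P.IsReduced] [P.IsIrreducible] [P.IsCrystallographic] in
lemma IsLargestShortRoot.rootForm_root_eq_zero (h : b.IsLargestShortRoot T γ) {x : M}
    (hx : ∀ a ∈ T, P.RootForm x (P.root a) = 0) : P.RootForm x (P.root γ) = 0 := by
  rw [rootForm_comm]
  refine b.rootForm_eq_zero fun a ha ↦ ?_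
  rw [rootForm_comm]
  exact hx a (h.suppOf_subset ha)

/-- On `S`, the cascade weight of `β` has the same scalar products as `β` itself, because `S` is
orthogonal to all earlier roots of the cascade. -/
lemma CascadeStep.rootForm_cascadeWeight (h : b.CascadeStep S β) {a : b.support} (ha : a ∈ S) :
    P.RootForm (b.cascadeWeight β) (P.root a) = P.RootForm (P.root β) (P.root a) := by
  induction h with
  | first h => rw [cascadeWeight_first h]
  | next hS hT hγ ih =>
    rw [hS.cascadeWeight_next hT hγ, map_add, LinearMap.add_apply, ih (hT.subset ha).1,
      rootForm_eq_zero_of_isComponentOf hT ha, zero_add]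

lemma CascadeStep.coroot'_cascadeWeight (h : b.CascadeStep S β) {a : b.support} (ha : a ∈ S) :
    P.coroot' a (b.cascadeWeight β) = P.coroot' a (P.root β) := by
  rw [← sub_eq_zero, ← map_sub, coroot'_eq_zero_iff, map_sub, LinearMap.sub_apply,
    h.rootForm_cascadeWeight ha, sub_self]

lemma CascadeStep.rootForm_cascadeWeight_self (h : b.CascadeStep S β) :
    P.RootForm (b.cascadeWeight β) (P.root β) = P.RootForm (P.root β) (P.root β) := by
  rw [← sub_eq_zero, ← LinearMap.sub_apply, ← map_sub]
  refine h.isLargestShortRoot.rootForm_root_eq_zero fun a ha ↦ ?_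
  rw [map_sub, LinearMap.sub_apply, h.rootForm_cascadeWeight ha, sub_self]

omit [P.IsCrystallographic] [P.IsReduced] [P.IsIrreducible] in
lemma CascadeStep.eq_or_rootForm_eq_zero (h : b.CascadeStep S β)
    (hβ₁ : b.IsLargestShortRoot Set.univ β₁) :
    β = β₁ ∨ ∀ a ∈ S, P.RootForm (P.root β₁) (P.root a) = 0 := by
  induction h with
  | first h => exact Or.inl (h.unique hβ₁)
  | next hS hT hγ ih =>
    refine Or.inr fun a ha ↦ ?_
    rcases ih with rfl | ih
    · exact rootForm_eq_zero_of_isComponentOf hT ha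
    · exact ih a (hT.subset ha).1

lemma CascadeStep.rootForm_cascadeWeight_first (h : b.CascadeStep S β)
    (hβ₁ : b.IsLargestShortRoot Set.univ β₁) :
    P.RootForm (b.cascadeWeight β) (P.root β₁) = P.RootForm (P.root β₁) (P.root β₁) := by
  induction h with
  | first h =>
    obtain rfl := h.unique hβ₁
    rw [cascadeWeight_first h]
  | next hS hT hγ ih =>
    rw [hS.cascadeWeight_next hT hγ, map_add, LinearMap.add_apply, ih, add_eq_left, rootForm_comm]
    refine hγ.rootForm_root_eq_zero fun a ha ↦ ?_
    rcases hS.eq_or_rootForm_eq_zero hβ₁ with rfl | h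
    · exact rootForm_eq_zero_of_isComponentOf hT ha
    · exact h a (hT.subset ha).1

lemma CascadeStep.coroot'_cascadeWeight_nonpos (h : b.CascadeStep S β) {a c : b.support}
    (ha : a ∉ S) (hc : c ∈ S) (hca : P.RootForm (P.root c) (P.root a) ≠ 0) :
    P.coroot' a (b.cascadeWeight β) ≤ 0 := by
  induction h with
  | first h => exact (ha trivial).elim
  | @next S T β γ hS hT hγ ih =>
    have h := CascadeStep.next hS hT hγ
    rw [hS.cascadeWeight_next hT hγ, map_add, h.coroot'_eq_neg_one ha hc hca]
    by_cases haS : a ∈ S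
    · have e := hS.coroot'_cascadeWeight haS
      rcases coroot'_mem_of_adj hS.isLargestShortRoot.1.1
        (rootForm_eq_zero_of_isComponentOf hT hc) hca with h0 | h0 | h0 <;> linarith
    · linarith [ih haS (hT.subset hc).1]

/-- Let `β'`, `β`, `γ` be consecutive members of the cascade, and `a` a simple root pairing to
`1`, `-1`, `-1` with them. These four roots span a system of type `D₄`, whose root
`β' - a - β - γ` is positive since its scalar product with `β'` is positive. Hence the
coefficients of `β'` on the support of `γ` exceed those of `γ`. -/
lemma CascadeStep.repr_lt_of_coroot'_eq (hS' : b.CascadeStep S' β')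
    (hS : b.dynkinGraph.IsComponentOf S (S' \ {a | P.RootForm (P.root β') (P.root a) ≠ 0}))
    (hβ : b.IsLargestShortRoot S β)
    (hT : b.dynkinGraph.IsComponentOf T (S \ {a | P.RootForm (P.root β) (P.root a) ≠ 0}))
    (hγ : b.IsLargestShortRoot T γ) {a : b.support} (ha : a ∈ S')
    (h1 : P.coroot' a (P.root β') = 1) (h2 : P.coroot' a (P.root β) = -1)
    (h3 : P.coroot' a (P.root γ) = -1) {x : b.support} (hx : x ∈ T) :
    b.toWeightBasis.repr (P.root γ) x < b.toWeightBasis.repr (P.root β') x := by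
  have stepS := CascadeStep.next hS' hS hβ
  have stepT := CascadeStep.next stepS hT hγ
  have hTS : T ⊆ S := hT.subset.trans Set.sdiff_subset
  have hSS' : S ⊆ S' := hS.subset.trans Set.sdiff_subset
  have o12 : P.RootForm (P.root β') (P.root β) = 0 :=
    hβ.rootForm_root_eq_zero fun c hc ↦ rootForm_eq_zero_of_isComponentOf hS hc
  have o13 : P.RootForm (P.root β') (P.root γ) = 0 :=
    hγ.rootForm_root_eq_zero fun c hc ↦ rootForm_eq_zero_of_isComponentOf hS (hTS hc)
  have o23 : P.RootForm (P.root β) (P.root γ) = 0 :=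
    hγ.rootForm_root_eq_zero fun c hc ↦ rootForm_eq_zero_of_isComponentOf hT hc
  have e1 := P.coroot'_mul_rootForm (P.root β') a
  have e2 := P.coroot'_mul_rootForm (P.root β) a
  have e3 := P.coroot'_mul_rootForm (P.root γ) a
  rw [h1] at e1
  rw [h2] at e2
  rw [h3] at e3
  have lβ := hβ.1.1.length_eq hS'.isLargestShortRoot.1.1
  have lγ := hγ.1.1.length_eq hS'.isLargestShortRoot.1.1
  have hs := P.rootForm_root_pos β'
  -- The vector `β' - a - β - γ` has square length `3 s - 2 (a, a)`, where `s` is that of the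
  -- short roots. It cannot be negative, so `a` is short.
  have la : P.RootForm (P.root a) (P.root a) = P.RootForm (P.root β') (P.root β') := by
    obtain ⟨n, hn⟩ := hS'.isLargestShortRoot.1.1.exists_length_eq (a : ι)
    have hle := hS'.isLargestShortRoot.1.1 a
    have hsq := P.zero_le_rootForm (P.root β' - P.root a - P.root β - P.root γ)
    simp only [map_sub, LinearMap.sub_apply, P.rootForm_comm (P.root a) (P.root β'),
      P.rootForm_comm (P.root a) (P.root β), P.rootForm_comm (P.root a) (P.root γ),
      P.rootForm_comm (P.root β) (P.root β'), P.rootForm_comm (P.root γ) (P.root β'),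
      P.rootForm_comm (P.root γ) (P.root β), o12, o13, o23, lβ, lγ] at hsq
    have hn1 : (n : ℝ) < 2 := by
      by_contra! h
      nlinarith
    have hn2 : (0 : ℝ) < n := by
      by_contra! h
      nlinarith
    have : n = 1 := by
      have h1' : n < 2 := by exact_mod_cast hn1
      have h2' : 0 < n := by exact_mod_cast hn2
      omega
    rw [hn, this]
    simp
  have c1 : P.coroot' β (P.root β' - P.root a) = 1 := by
    have := P.coroot'_mul_rootForm (P.root β' - P.root a) β
    rw [map_sub P.RootForm, LinearMap.sub_apply, o12, P.rootForm_comm (P.root a), lβ] at this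
    exact mul_right_cancel₀ hs.ne' (by linarith)
  have c2 : P.coroot' γ (P.root β' - P.root a - P.root β) = 1 := by
    have := P.coroot'_mul_rootForm (P.root β' - P.root a - P.root β) γ
    rw [map_sub P.RootForm, map_sub P.RootForm, LinearMap.sub_apply, LinearMap.sub_apply, o13,
      o23, P.rootForm_comm (P.root a), lγ] at this
    exact mul_right_cancel₀ hs.ne' (by linarith)
  obtain ⟨θ, hθ⟩ : ∃ θ, P.root θ = P.root β' - P.root a - P.root β - P.root γ := by
    refine ⟨P.reflectionPerm γ (P.reflectionPerm β (P.reflectionPerm a β')), ?_⟩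
    rw [root_reflectionPerm, root_reflectionPerm, root_reflectionPerm,
      P.reflection_apply a, h1, one_smul, P.reflection_apply β, c1, one_smul,
      P.reflection_apply γ, c2, one_smul]
  have hsingle (c : b.support) : 0 ≤ b.toWeightBasis.repr (P.root a) c := by
    classical
    rw [b.toWeightBasis_repr_root, Finsupp.single_apply]
    split_ifs <;> norm_num
  have hpos : ∀ c, 0 ≤ b.toWeightBasis.repr (P.root θ) c := by
    refine (b.repr_root_nonneg_or_nonpos θ).resolve_right fun hneg ↦ ?_
    have hle : 0 ≤ P.RootForm (-P.root θ) (P.root β') := by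
      refine b.rootForm_nonneg (fun c ↦ by simpa using hneg c) fun c hc ↦ ?_
      rw [rootForm_comm]
      refine hS'.isLargestShortRoot.rootForm_nonneg ?_
      by_contra hcS'
      apply hc
      have hca : (a : b.support) ≠ c := by
        rintro rfl
        exact hcS' ha
      simp [hθ, hS'.repr_eq_zero hcS', stepS.repr_eq_zero fun h ↦ hcS' (hSS' h),
        stepT.repr_eq_zero fun h ↦ hcS' (hSS' (hTS h)), Finsupp.single_eq_of_ne' hca]
    simp only [hθ, map_neg, map_sub, LinearMap.neg_apply, LinearMap.sub_apply,
      P.rootForm_comm (P.root a) (P.root β'), P.rootForm_comm (P.root β) (P.root β'),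
      P.rootForm_comm (P.root γ) (P.root β'), o12, o13] at hle
    linarith
  have := hpos x
  rw [hθ] at this
  simp only [map_sub, Finsupp.sub_apply] at this
  linarith [hsingle x, stepS.repr_pos (hTS hx)]

/-- If `ξ_β` is not dominant, then `β₁ - β` has full support. Indeed, when the scalar product
with a simple root first becomes negative along the cascade, the last three members of the
cascade pair with it to `1`, `-1`, `-1`. -/
lemma CascadeStep.repr_lt_of_not_dominant (h : b.CascadeStep S β)
    (hβ₁ : b.IsLargestShortRoot Set.univ β₁) {a : b.support}
    (ha : P.coroot' a (b.cascadeWeight β) < 0) (x : b.support) :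
    b.toWeightBasis.repr (P.root β) x < b.toWeightBasis.repr (P.root β₁) x := by
  induction h with
  | first h =>
    rw [cascadeWeight_first h] at ha
    exact (ha.not_ge (P.coroot'_nonneg_iff.mpr (h.rootForm_nonneg trivial))).elim
  | @next S T β γ hS hT hγ ih =>
    have stepT := CascadeStep.next hS hT hγ
    have hTS : T ⊆ S := hT.subset.trans Set.sdiff_subset
    rcases lt_or_ge (P.coroot' a (b.cascadeWeight β)) 0 with hneg | hnn
    · exact (hS.isLargestShortRoot.repr_le_of_subset hγ hTS x).trans_lt (ih hneg)
    by_cases hx : x ∉ T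
    · rw [stepT.repr_eq_zero hx]
      exact (CascadeStep.first hβ₁).repr_pos trivial
    rw [not_not] at hx
    have haT : a ∉ T := by
      intro haT
      refine ha.not_ge (P.coroot'_nonneg_iff.mpr ?_)
      rw [stepT.rootForm_cascadeWeight haT]
      exact hγ.rootForm_nonneg haT
    obtain ⟨c, hc, hca⟩ : ∃ c ∈ T, P.RootForm (P.root c) (P.root a) ≠ 0 := by
      by_contra! hcon
      rw [hS.cascadeWeight_next hT hγ, map_add] at ha
      have : P.coroot' a (P.root γ) = 0 := by
        rw [coroot'_eq_zero_iff, rootForm_comm]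
        refine hγ.rootForm_root_eq_zero fun c hc ↦ ?_
        rw [rootForm_comm]
        exact hcon c hc
      linarith
    have haS : a ∉ S := by
      intro haS
      by_cases h0 : P.RootForm (P.root β) (P.root a) = 0
      · refine haT (hT.mem_of_adj hc ⟨haS, not_not.mpr h0⟩ ⟨?_, hca⟩)
        rintro rfl
        exact haT hc
      · have hp := P.coroot'_nonneg_iff.mpr (hS.isLargestShortRoot.rootForm_nonneg haS)
        rw [hS.cascadeWeight_next hT hγ, map_add, stepT.coroot'_eq_neg_one haT hc hca,
          hS.coroot'_cascadeWeight haS] at ha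
        rw [← coroot'_eq_zero_iff] at h0
        rcases coroot'_mem_of_adj hS.isLargestShortRoot.1.1
          (rootForm_eq_zero_of_isComponentOf hT hc) hca with h | h | h
        · exact h0 h
        · linarith
        · linarith
    have hξ : P.coroot' a (b.cascadeWeight β) = 0 :=
      le_antisymm (hS.coroot'_cascadeWeight_nonpos haS (hTS hc) hca) hnn
    have h3 := stepT.coroot'_eq_neg_one haT hc hca
    have h2 := hS.coroot'_eq_neg_one haS (hTS hc) hca
    cases hS with
    | first h => exact (haS trivial).elim
    | @next S' _ β' _ hS' hSS' hβ =>
      rw [hS'.cascadeWeight_next hSS' hβ, map_add, h2] at hξ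
      have hsub : S ⊆ S' := hSS'.subset.trans Set.sdiff_subset
      have haS' : a ∈ S' := by
        by_contra haS'
        linarith [hS'.coroot'_cascadeWeight_nonpos haS' (hsub (hTS hc)) hca]
      have e := hS'.coroot'_cascadeWeight haS'
      refine (hS'.repr_lt_of_coroot'_eq hSS' hβ hT hγ haS' (by linarith) h2 h3 hx).trans_le ?_
      exact hβ₁.repr_le_of_subset hS'.isLargestShortRoot (Set.subset_univ _) x

end RootPairing.Base

/-! ### The component of `α₀` in the extended Dynkin diagram -/

namespace RootPairing.Base

variable {ι M N : Type*} [Fintype ι] [AddCommGroup M] [Module ℝ M] [AddCommGroup N] [Module ℝ N]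
  {P : RootPairing ι ℝ M N} {b : P.Base} {S : Set b.support} {β β₁ : ι}

/-- A set of simple roots that contains all its neighbours in `Δ_x`, and those of `α₀`, contains
the component of `α₀`. -/
lemma extComponent_subset {x : M} {D : Set b.support}
    (h₀ : ∀ a ∈ b.orthSimple x, P.RootForm (P.root β₁) (P.root a) ≠ 0 → a ∈ D)
    (hD : ∀ a ∈ b.orthSimple x, ∀ c ∈ D, P.RootForm (P.root c) (P.root a) ≠ 0 → a ∈ D) :
    b.extComponent β₁ x ⊆ D := by
  rintro a ⟨⟨v, hv⟩, hreach, hav⟩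
  rw [SimpleGraph.ConnectedComponent.mem_supp_iff, SimpleGraph.ConnectedComponent.eq] at hreach
  replace hreach := hreach.symm
  rw [SimpleGraph.reachable_iff_reflTransGen] at hreach
  obtain rfl : v = some a := hav
  suffices key : ∀ w, Relation.ReflTransGen ((b.extDynkinGraph β₁).induce
      (b.extOrthSimple x)).Adj ⟨none, Set.mem_insert _ _⟩ w → ∀ d, w.1 = some d → d ∈ D from
    key _ hreach a rfl
  intro w hw
  induction hw with
  | refl => simp
  | @tail u w _ huw ih =>
    intro d hd
    have hdx : d ∈ b.orthSimple x := by
      have := w.2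
      rw [hd] at this
      simpa [extOrthSimple] using this
    have hadj : P.RootForm ((u : Option b.support).elim (-P.root β₁) fun a ↦ P.root a)
        ((w : Option b.support).elim (-P.root β₁) fun a ↦ P.root a) ≠ 0 := huw.2
    rw [hd] at hadj
    rcases hu : (u : Option b.support) with _ | c
    · rw [hu] at hadj
      exact h₀ d hdx (by simpa using hadj)
    · rw [hu] at hadj
      exact hD d hdx c (ih c hu) hadj

lemma mem_extComponent_of_rootForm_ne_zero {x : M} {a : b.support} (ha : a ∈ b.orthSimple x)
    (h : P.RootForm (P.root β₁) (P.root a) ≠ 0) : a ∈ b.extComponent β₁ x := by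
  have hmem : some a ∈ b.extOrthSimple x := Or.inr ⟨a, ha, rfl⟩
  have hadj : ((b.extDynkinGraph β₁).induce (b.extOrthSimple x)).Adj
      ⟨none, Set.mem_insert _ _⟩ ⟨some a, hmem⟩ :=
    ⟨by simp, by simpa using h⟩
  exact ⟨⟨some a, hmem⟩, (SimpleGraph.ConnectedComponent.sound hadj.reachable).symm, rfl⟩

lemma mem_extComponent_of_adj {x : M} {a c : b.support} (ha : a ∈ b.orthSimple x)
    (hc : c ∈ b.extComponent β₁ x) (h : P.RootForm (P.root c) (P.root a) ≠ 0) :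
    a ∈ b.extComponent β₁ x := by
  rcases eq_or_ne c a with rfl | hca
  · exact hc
  obtain ⟨⟨v, hv⟩, hreach, hcv⟩ := hc
  obtain rfl : v = some c := hcv
  have hmem : some a ∈ b.extOrthSimple x := Or.inr ⟨a, ha, rfl⟩
  have hadj : ((b.extDynkinGraph β₁).induce (b.extOrthSimple x)).Adj
      ⟨some c, hv⟩ ⟨some a, hmem⟩ :=
    ⟨by simpa using hca, h⟩
  refine ⟨⟨some a, hmem⟩, ?_, rfl⟩
  rw [SimpleGraph.ConnectedComponent.mem_supp_iff] at hreach ⊢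
  rw [← hreach]
  exact (SimpleGraph.ConnectedComponent.sound hadj.reachable).symm

variable [P.IsRootSystem] [P.IsCrystallographic] [P.IsReduced] [P.IsIrreducible]

/-- If `ξ_β` is dominant, it is orthogonal to the support of `β₁ - β`: this difference is a
non-negative combination of simple roots, and it is orthogonal to `ξ_β` because `β₁` and `β` are
members of the same length of the orthogonal family with sum `ξ_β`. -/
lemma CascadeStep.suppOf_sub_subset_orthSimple (h : b.CascadeStep S β)
    (hβ₁ : b.IsLargestShortRoot Set.univ β₁)
    (hdom : b.IsDominantWeight (b.cascadeWeight β)) :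
    b.suppOf (P.root β₁ - P.root β) ⊆ b.orthSimple (b.cascadeWeight β) := by
  intro a ha
  have hsum : P.RootForm (P.root β₁ - P.root β) (b.cascadeWeight β) = 0 := by
    rw [rootForm_comm, map_sub, h.rootForm_cascadeWeight_first hβ₁, h.rootForm_cascadeWeight_self,
      hβ₁.1.1.length_eq h.isLargestShortRoot.1.1, sub_self]
  have hnn (c : b.support) : 0 ≤ b.toWeightBasis.repr (P.root β₁ - P.root β) c := by
    have := hβ₁.repr_le_of_subset h.isLargestShortRoot (Set.subset_univ _) c
    simpa using this
  rw [b.rootForm_eq_sum, Finset.sum_eq_zero_iff_of_nonneg fun c _ ↦ mul_nonneg (hnn c) (by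
    rw [rootForm_comm]
    exact P.coroot'_nonneg_iff.mp (hdom c))] at hsum
  refine P.coroot'_eq_zero_iff.mpr ?_
  rw [rootForm_comm]
  exact (mul_eq_zero.mp (hsum a (Finset.mem_univ a))).resolve_left ha

/-- The support of `β₁ - β` together with `α₀` is connected. Otherwise split `β₁ - β = x + y`
with `y` supported off the component of `α₀`; then `y` is orthogonal to `β₁ - x`, so that
`(β, β) = (β₁ - x, β₁ - x) + (y, y)` exceeds the minimal square length in the root lattice. -/
lemma CascadeStep.suppOf_sub_subset_extComponent (h : b.CascadeStep S β)
    (hβ₁ : b.IsLargestShortRoot Set.univ β₁) {z : M}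
    (hz : b.suppOf (P.root β₁ - P.root β) ⊆ b.orthSimple z) :
    b.suppOf (P.root β₁ - P.root β) ⊆ b.extComponent β₁ z := by
  classical
  intro a₀ ha₀
  by_contra hJ
  set J := b.extComponent β₁ z
  set μ := P.root β₁ - P.root β with hμ
  have hnn (c : b.support) : 0 ≤ b.toWeightBasis.repr μ c := by
    have := hβ₁.repr_le_of_subset h.isLargestShortRoot (Set.subset_univ _) c
    simpa [hμ] using this
  have hroot (i : ι) : P.root i ∈ P.rootSpan ℤ := Submodule.subset_span ⟨i, rfl⟩
  set x : M := ∑ a, (if a ∈ J then b.toWeightBasis.repr μ a else 0) • b.toWeightBasis a with hx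
  have hxrepr (a) : b.toWeightBasis.repr x a = if a ∈ J then b.toWeightBasis.repr μ a else 0 := by
    rw [hx, b.toWeightBasis.repr_sum_self]
  have hxmem : x ∈ P.rootSpan ℤ := by
    refine Submodule.sum_mem _ fun a _ ↦ ?_
    rw [toWeightBasis_apply]
    split_ifs
    · obtain ⟨n, hn⟩ := b.exists_int_repr_eq (sub_mem (hroot β₁) (hroot β) : μ ∈ _) a
      rw [hn, Int.cast_smul_eq_zsmul]
      exact zsmul_mem (hroot a) n
    · rw [zero_smul]
      exact zero_mem _
  set y := μ - x with hy
  have hyrepr (a) : b.toWeightBasis.repr y a = if a ∈ J then 0 else b.toWeightBasis.repr μ a := by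
    rw [hy, map_sub, Finsupp.sub_apply, hxrepr]
    split_ifs <;> simp
  have hy0 : 0 < b.toWeightBasis.repr y a₀ := by
    rw [hyrepr, if_neg hJ]
    exact lt_of_le_of_ne (hnn a₀) (Ne.symm ha₀)
  have hβ : P.root β = P.root β₁ - x - y := by
    rw [hy, hμ]
    abel
  have hu : P.root β₁ - x ≠ 0 := by
    intro hu
    rw [hu, zero_sub] at hβ
    have := h.isLargestShortRoot.repr_nonneg a₀
    rw [hβ, map_neg, Finsupp.neg_apply] at this
    linarith
  have horth : P.RootForm y (P.root β₁ - x) = 0 := by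
    refine b.rootForm_eq_zero fun c hc ↦ ?_
    have hcy : b.toWeightBasis.repr y c ≠ 0 := hc
    rw [hyrepr] at hcy
    have hcJ : c ∉ J := fun hcJ ↦ hcy (if_pos hcJ)
    rw [if_neg hcJ] at hcy
    have hcz := hz hcy
    rw [rootForm_comm, map_sub, LinearMap.sub_apply, sub_eq_zero]
    trans 0
    · by_contra hne
      exact hcJ (mem_extComponent_of_rootForm_ne_zero hcz hne)
    · refine (b.rootForm_eq_zero fun d hd ↦ ?_).symm
      have hdx : b.toWeightBasis.repr x d ≠ 0 := hd
      rw [hxrepr] at hdx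
      have hdJ : d ∈ J := by
        by_contra hdJ
        exact hdx (if_neg hdJ)
      by_contra hne
      exact hcJ (mem_extComponent_of_adj hcz hdJ hne)
  have hle := h.isLargestShortRoot.1.1.rootForm_le (sub_mem (hroot β₁) hxmem) hu
  have hpos : 0 < P.RootForm y y := by
    refine P.rootForm_pos_of_ne_zero (by simp) ?_
    intro h0
    simp [h0] at hy0
  have hexp : P.RootForm (P.root β) (P.root β) =
      P.RootForm (P.root β₁ - x) (P.root β₁ - x) + P.RootForm y y := by
    generalize P.root β₁ - x = u at hβ horth
    rw [hβ]
    simp only [map_sub, LinearMap.sub_apply, P.rootForm_comm u y, horth]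
    ring
  linarith

end RootPairing.Base

/-! ### The dominance criterion and the component of `α₀` -/

open RootPairing RootPairing.Base in
theorem proposition12 {ι M N : Type*} [Fintype ι] [AddCommGroup M] [Module ℝ M]
    [AddCommGroup N] [Module ℝ N] (P : RootPairing ι ℝ M N) [P.IsRootSystem]
    [P.IsCrystallographic] [P.IsReduced] [P.IsIrreducible] (b : P.Base)
    (β₁ : ι) (hβ₁ : b.IsLargestShortRoot Set.univ β₁)
    (β : ι) (hβ : β ∈ b.kostantCascade) :
    (b.IsDominantWeight (b.cascadeWeight β) ↔
      b.suppOf (P.root β₁ - P.root β) ≠ Set.univ) ∧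
    (b.IsDominantWeight (b.cascadeWeight β) →
      b.extComponent β₁ (b.cascadeWeight β) = b.suppOf (P.root β₁ - P.root β)) := by
  obtain ⟨S, h⟩ := hβ
  have hrepr (a : b.support) : b.toWeightBasis.repr (P.root β₁ - P.root β) a =
      b.toWeightBasis.repr (P.root β₁) a - b.toWeightBasis.repr (P.root β) a := by simp
  have hnn (a : b.support) : 0 ≤ b.toWeightBasis.repr (P.root β₁ - P.root β) a := by
    rw [hrepr, sub_nonneg]
    exact hβ₁.repr_le_of_subset h.isLargestShortRoot (Set.subset_univ _) a
  refine ⟨⟨fun hdom huniv ↦ ?_, fun hne a ↦ ?_⟩, fun hdom ↦ ?_⟩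
  · -- `ξ_β` would be orthogonal to all simple roots, but it is not orthogonal to `β₁`.
    have hsub := h.suppOf_sub_subset_orthSimple hβ₁ hdom
    rw [huniv] at hsub
    refine (P.rootForm_root_pos β₁).ne' ?_
    rw [← h.rootForm_cascadeWeight_first hβ₁]
    exact hβ₁.rootForm_root_eq_zero fun a ha ↦ P.coroot'_eq_zero_iff.mp (hsub ha)
  · by_contra! hneg
    refine hne (Set.eq_univ_of_forall fun x ↦ ?_)
    change _ ≠ _
    rw [hrepr, sub_ne_zero]
    exact (h.repr_lt_of_not_dominant hβ₁ hneg x).ne'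
  · have hsub := h.suppOf_sub_subset_orthSimple hβ₁ hdom
    -- A simple root outside the support of `β₁ - β` occurs in `β` with the same coefficient as
    -- in `β₁`, so it lies in `S`, where `ξ_β` and `β` have the same scalar products.
    have key : ∀ a ∈ b.orthSimple (b.cascadeWeight β), a ∉ b.suppOf (P.root β₁ - P.root β) →
        P.RootForm (P.root β) (P.root a) = 0 ∧ P.RootForm (P.root β₁) (P.root a) = 0 := by
      intro a ha haD
      have he : b.toWeightBasis.repr (P.root β₁ - P.root β) a = 0 := not_not.mp haD
      have haS : a ∈ S := by
        by_contra haS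
        rw [hrepr, h.repr_eq_zero haS, sub_zero] at he
        exact ((CascadeStep.first hβ₁).repr_pos (Set.mem_univ a)).ne' he
      have h0 : P.RootForm (P.root β) (P.root a) = 0 := by
        rw [← h.rootForm_cascadeWeight haS]
        exact P.coroot'_eq_zero_iff.mp ha
      rcases h.eq_or_rootForm_eq_zero hβ₁ with rfl | h1
      · exact ⟨h0, h0⟩
      · exact ⟨h0, h1 a haS⟩
    refine (extComponent_subset (fun a ha ha1 ↦ ?_) fun a ha c hc hca ↦ ?_).antisymm
      (h.suppOf_sub_subset_extComponent hβ₁ hsub)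
    · by_contra haD
      exact ha1 (key a ha haD).2
    · by_contra haD
      have hneg := b.rootForm_neg_of_adj hnn haD hc hca
      rw [map_sub, LinearMap.sub_apply, (key a ha haD).1, (key a ha haD).2, sub_zero] at hneg
      exact lt_irrefl _ hneg
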